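/- Let $R$ be a commutative $\mathbb{Q}$-algebra. Functions of the times $x=(x_1,x_2,\dots)$, $y=(y_1,y_2,\dots)$ are formal power series in $x,y$ over $R$; matrices are indexed by $\mathbb{Z}\times\mathbb{Z}$ and have such functions as entries; infinite sums are taken coefficientwise. Put $\Lambda=(\delta_{j-i,1})_{i,j}$, $\xi(x,z)=\sum_{n\ge1}x_nz^n$, $\chi(z)=(z^i)_{i\in\mathbb{Z}}$, $\chi^*(z)=\chi(z^{-1})$, $(a\otimes b)_{ij}=a_ib_j$. For a matrix $P$ let $P_u$ be its upper triangular part (with diagonal) and $P_l$ its strictly lower triangular part, and for a pair set $$(P_1,P_2)_+=(P_{1u}+P_{2l},\,P_{1u}+P_{2l}),\qquad (P_1,P_2)_-=(P_{1l}-P_{2l},\,P_{2u}-P_{1u}).$$ Let $S_1=\sum_{i\ge0}\mathrm{diag}[c_i(s)]\Lambda^{-i}$ with $c_0=1$ and $S_2=\sum_{i\ge0}\mathrm{diag}[c'_i(s)]\Lambda^{i}$ with $c'_0(s)$ invertible for every $s$. Set $W_1=S_1e^{\xi(x,\Lambda)}$, $W_2=S_2e^{\xi(y,\Lambda^{-1})}$,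 $W=(W_1,W_2)$, $L_1=W_1\Lambda W_1^{-1}$, $L_2=W_2\Lambda^{-1}W_2^{-1}$, and suppose that $W$ solves the Toda lattice hierarchy $$\partial_{x_n}W=(L_1^n,0)_+W,\qquad \partial_{y_n}W=(0,L_2^n)_+W,\qquad n\ge1 .$$ Let $\varepsilon=\mathrm{diag}[s]\Lambda^{-1}$, $\varepsilon^*=-\varepsilon^T+\Lambda$, let $M_1=W_1\varepsilon W_1^{-1}$ and $M_2=W_2\varepsilon^*W_2^{-1}$ be the Orlov–Shulman operators, and let $\Psi_i(z)=W_i\chi(z)$ and $\Psi_i^*(z)=(W_i^{-1})^T\chi^*(z)$ be the wave and adjoint wave functions. Put $$Y_i(\lambda,\mu)=\sum_{m\ge0}\frac{(\mu-\lambda)^m}{m!}\sum_{l\in\mathbb{Z}}\lambda^{-l-m-1}M_i^mL_i^{m+l},\qquad i=1,2 .$$ Series in $\lambda,\mu$ are formal series in non-negative powers of $\mu-\lambda$ and arbitrary integer powers of $\lambda$, and $f(\mu)$ is expanded as $e^{(\mu-\lambda)\partial_\lambda}f(\lambda)$, that is, $\mu^k=\sum_{m\ge0}\binom{k}{m}\lambda^{k-m}(\mu-\lambda)^m$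 for $k\in\mathbb{Z}$. Then all the sums that occur in the following Kronecker products converge, and $$Y_1(\lambda,\mu)=\lambda^{-1}\Psi_1(\mu)\otimes\Psi_1^*(\lambda),\qquad Y_2(\lambda,\mu)=\lambda^{-1}\Psi_2(\mu^{-1})\otimes\Psi_2^*(\lambda^{-1}).$$ Moreover, define the flows $$\partial_{\alpha_1}W_1=\big(\lambda^{-1}\Psi_1(\mu)\otimes\Psi_1^*(\lambda)\big)_lW_1,\qquad \partial_{\alpha_1}W_2=-\big(\lambda^{-1}\Psi_1(\mu)\otimes\Psi_1^*(\lambda)\big)_uW_2,$$ $$\partial_{\alpha_2}W_1=-\big(\lambda^{-1}\Psi_2(\mu^{-1})\otimes\Psi_2^*(\lambda^{-1})\big)_lW_1,\qquad \partial_{\alpha_2}W_2=\big(\lambda^{-1}\Psi_2(\mu^{-1})\otimes\Psi_2^*(\lambda^{-1})\big)_uW_2,$$ and the additional symmetries $$\partial_{x^*_{m,l}}W=-(M_1^mL_1^l,0)_-W,\qquad \partial_{y^*_{m,l}}W=-(0,M_2^mL_2^l)_-W .$$ Call a vector $q$ an eigenfunction if $\partial_{x_n}q=(L_1^n)_uq$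 and $\partial_{y_n}q=(L_2^n)_lq$ for all $n\ge 1$, and a vector $r$ an adjoint eigenfunction if $\partial_{x_n}r=-\big((L_1^n)_u\big)^Tr$ and $\partial_{y_n}r=-\big((L_2^n)_l\big)^Tr$ for all $n\ge 1$; the squared eigenfunction flow of such a pair is $\partial_\alpha W=(q\otimes r,0)_-W$. Then $\Psi_1(z)$ and $-\Psi_2(z^{-1})$ are eigenfunctions, $z^{-1}\Psi_1^*(z)$ and $z^{-1}\Psi_2^*(z^{-1})$ are adjoint eigenfunctions, $\partial_{\alpha_1}$ and $\partial_{\alpha_2}$ are the squared eigenfunction flows of the pairs $\Psi_1(\mu),\ \lambda^{-1}\Psi_1^*(\lambda)$ and $-\Psi_2(\mu^{-1}),\ \lambda^{-1}\Psi_2^*(\lambda^{-1})$, and they generate the additional symmetries: on the wave matrices, $$\partial_{\alpha_1}=-\sum_{m\ge0}\frac{(\mu-\lambda)^m}{m!}\sum_{k\in\mathbb{Z}}\lambda^{-k-m-1}\partial_{x^*_{m,m+k}},\qquad \partial_{\alpha_2}=-\sum_{m\ge0}\frac{(\mu-\lambda)^m}{m!}\sum_{k\in\mathbb{Z}}\lambda^{-k-m-1}\partial_{y^*_{m,m+k}}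 .$$ -/

import Mathlib

noncomputable section

namespace Toda

open Finset

/-- The index set of the times: `Sum.inl n` is `x_n` and `Sum.inr n` is `y_n`, `n = 1, 2, …`. -/
abbrev Times : Type := ℕ+ ⊕ ℕ+

/-- The functions of the times `(x, y)`: formal power series over the ring of constants `R`. -/
abbrev Fn (R : Type*) : Type _ := MvPowerSeries Times R

/-- Matrices indexed by `ℤ × ℤ` whose entries are functions of the times. -/
abbrev Mat (R : Type*) : Type _ := Matrix ℤ ℤ (Fn R)

/-- `∂_{x_n}` (for `v = Sum.inl n`) and `∂_{y_n}` (for `v = Sum.inr n`). -/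
def partialT {R : Type*} [CommRing R] (v : Times) (f : Fn R) : Fn R := MvPowerSeries.pderiv R v f

/-- A family of power series is summable if every monomial occurs in only finitely many members. -/
def FSummable {R ι : Type*} [CommRing R] (f : ι → Fn R) : Prop :=
  ∀ d, (fun i => MvPowerSeries.coeff d (f i)).HasFiniteSupport

/-- The sum of a summable family of power series, computed coefficient by coefficient. -/
def fsum {R ι : Type*} [CommRing R] (f : ι → Fn R) : Fn R :=
  fun d => ∑ᶠ i, MvPowerSeries.coeff d (f i)

/-- The product `(P Q)_{ij} = ∑_k P_{ik} Q_{kj}`. -/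
def mmul {R : Type*} [CommRing R] (P Q : Mat R) : Mat R := fun i j => fsum fun k => P i k * Q k j

/-! ### Basic facts on formal sums -/

section Sums

variable {R : Type*} [CommRing R] {ι κ : Type*}

theorem coeff_fsum (f : ι → Fn R) (d : Times →₀ ℕ) :
    MvPowerSeries.coeff d (fsum f) = ∑ᶠ i, MvPowerSeries.coeff d (f i) := rfl

theorem fsum_add {f g : ι → Fn R} (hf : FSummable f) (hg : FSummable g) :
    (fsum fun i => f i + g i) = fsum f + fsum g := by
  ext d
  simp only [coeff_fsum, map_add]
  exact finsum_add_distrib (hf d) (hg d)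

theorem fsum_single (f : ι → Fn R) (a : ι) (h : ∀ i, i ≠ a → f i = 0) : fsum f = f a := by
  ext d
  rw [coeff_fsum]
  exact finsum_eq_single _ a fun i hi => by rw [h i hi, map_zero]

theorem fsum_zero : (fsum fun _ : ι => (0 : Fn R)) = 0 := by
  ext d
  simp [coeff_fsum]

theorem FSummable.mul_right {f : ι → Fn R} (hf : FSummable f) (c : Fn R) :
    FSummable fun i => f i * c := by
  classical
  intro d
  refine Set.Finite.subset (s := ⋃ p ∈ antidiagonal d,
    Function.support fun i => MvPowerSeries.coeff p.1 (f i)) ?_ ?_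
  · exact Set.Finite.biUnion (antidiagonal d).finite_toSet fun p _ => hf p.1
  · intro i hi
    by_contra hc
    simp only [Set.mem_iUnion, Function.mem_support, not_exists, not_not] at hc
    apply hi
    change MvPowerSeries.coeff d (f i * c) = 0
    rw [MvPowerSeries.coeff_mul]
    exact Finset.sum_eq_zero fun p hp => by rw [hc p hp, zero_mul]

theorem fsum_mul {f : ι → Fn R} (hf : FSummable f) (c : Fn R) :
    fsum f * c = fsum fun i => f i * c := by
  classical
  ext d
  rw [coeff_fsum, MvPowerSeries.coeff_mul]
  simp only [MvPowerSeries.coeff_mul, coeff_fsum]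
  rw [finsum_sum_comm]
  · exact Finset.sum_congr rfl fun p _ => finsum_mul' _ _ (hf p.1)
  · intro p _
    refine (hf p.1).subset fun i hi hc => hi ?_
    change MvPowerSeries.coeff p.1 (f i) * _ = 0
    have hc' : MvPowerSeries.coeff p.1 (f i) = 0 := hc
    rw [hc', zero_mul]

theorem mul_fsum {f : ι → Fn R} (hf : FSummable f) (c : Fn R) :
    c * fsum f = fsum fun i => c * f i := by
  simp only [mul_comm c, fsum_mul hf]

theorem fsum_prod {f : ι × κ → Fn R} (hf : FSummable f) :
    fsum f = fsum fun i => fsum fun k => f (i, k) := by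
  ext d
  simp only [coeff_fsum]
  exact finsum_curry _ (hf d)

theorem fsum_comm {f : ι → κ → Fn R} (hf : FSummable fun p : ι × κ => f p.1 p.2) :
    (fsum fun i => fsum fun k => f i k) = fsum fun k => fsum fun i => f i k := by
  have hg : FSummable fun p : κ × ι => f p.2 p.1 := fun d => by
    refine ((hf d).image Prod.swap).subset ?_
    rintro ⟨k, i⟩ h
    exact ⟨(i, k), h, rfl⟩
  rw [← fsum_prod (f := fun p : ι × κ => f p.1 p.2) hf,
    ← fsum_prod (f := fun p : κ × ι => f p.2 p.1) hg]
  ext d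
  rw [coeff_fsum, coeff_fsum, ← finsum_comp_equiv (Equiv.prodComm ι κ)]
  rfl

end Sums

/-! ### The two algebras of matrices -/

/-- The ideal of the power series all of whose monomials have `w`-weight at least `k`. -/
def weightIdeal (R : Type*) [CommRing R] (w : Times → ℕ) (k : ℤ) : Ideal (Fn R) where
  carrier := {f | ∀ d, MvPowerSeries.coeff d f ≠ 0 → k ≤ (Finsupp.weight w d : ℤ)}
  add_mem' := by
    intro f g hf hg d h
    by_contra hk
    apply h
    rw [map_add, not_imp_comm.1 (hf d) hk, not_imp_comm.1 (hg d) hk, add_zero]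
  zero_mem' := by
    intro d h
    simp at h
  smul_mem' := by
    classical
    intro c f hf d h
    rw [smul_eq_mul, MvPowerSeries.coeff_mul] at h
    obtain ⟨p, hp, hne⟩ := Finset.exists_ne_zero_of_sum_ne_zero h
    have h1 := hf p.2 (right_ne_zero_of_mul hne)
    rw [← Finset.HasAntidiagonal.mem_antidiagonal.1 hp, map_add]
    push_cast
    omega

/-- The matrices `P` for which there is a constant `C` such that every entry `P_{ij}` only has
monomials of `w`-weight at least `σ (j - i) - C`, where `σ = ±1`. -/
def bandSubmodule (R : Type*) [CommRing R] [Algebra ℚ R] (w : Times → ℕ) (σ : ℤˣ) :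
    Submodule ℚ (Mat R) where
  carrier := {P | ∃ C : ℤ, ∀ i j, P i j ∈ weightIdeal R w ((σ : ℤ) * (j - i) - C)}
  add_mem' := by
    rintro P Q ⟨C, hC⟩ ⟨D, hD⟩
    refine ⟨max C D, fun i j => add_mem (fun d h => ?_) (fun d h => ?_)⟩
    · have := hC i j d h
      have := le_max_left C D
      omega
    · have := hD i j d h
      have := le_max_right C D
      omega
  zero_mem' := ⟨0, fun i j => zero_mem _⟩
  smul_mem' := by
    rintro c P ⟨C, hC⟩
    refine ⟨C, fun i j => ?_⟩
    change c • P i j ∈ _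
    rw [Algebra.smul_def]
    exact Ideal.mul_mem_left _ _ (hC i j)

/-- The type of these matrices; it is a ring under `mmul`, all sums being summable. -/
abbrev Band (R : Type*) [CommRing R] [Algebra ℚ R] (w : Times → ℕ) (σ : ℤˣ) : Type _ :=
  ↥(bandSubmodule R w σ)

section Ring

variable {R : Type*} [CommRing R] {w : Times → ℕ} {σ : ℤˣ}

theorem weightIdeal_mono {k l : ℤ} (h : k ≤ l) : weightIdeal R w l ≤ weightIdeal R w k :=
  fun _ hf d hd => h.trans (hf d hd)

theorem mul_mem_weightIdeal {k l : ℤ} {f g : Fn R} (hf : f ∈ weightIdeal R w k)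
    (hg : g ∈ weightIdeal R w l) : f * g ∈ weightIdeal R w (k + l) := by
  classical
  intro d h
  rw [MvPowerSeries.coeff_mul] at h
  obtain ⟨p, hp, hne⟩ := Finset.exists_ne_zero_of_sum_ne_zero h
  have h1 := hf p.1 (left_ne_zero_of_mul hne)
  have h2 := hg p.2 (right_ne_zero_of_mul hne)
  rw [← Finset.HasAntidiagonal.mem_antidiagonal.1 hp, map_add]
  push_cast
  omega

theorem fsum_mem_weightIdeal {ι : Type*} {k : ℤ} {f : ι → Fn R}
    (hf : ∀ i, f i ∈ weightIdeal R w k) : fsum f ∈ weightIdeal R w k := by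
  intro d h
  by_contra hk
  apply h
  rw [coeff_fsum]
  exact finsum_eq_zero_of_forall_eq_zero fun i => not_imp_comm.1 (hf i d) hk

theorem fsummable_mul {P Q : Mat R} {C D : ℤ}
    (hP : ∀ i j, P i j ∈ weightIdeal R w ((σ : ℤ) * (j - i) - C))
    (hQ : ∀ i j, Q i j ∈ weightIdeal R w ((σ : ℤ) * (j - i) - D)) (i j : ℤ) :
    FSummable fun k => P i k * Q k j := by
  intro d
  set N : ℤ := (Finsupp.weight w d : ℤ) + |C| + |D| + |i| + |j| with hN
  refine (Set.finite_Icc (-N) N).subset fun k hk => ?_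
  have h1 := (weightIdeal R w _).mul_mem_right (Q k j) (hP i k) d hk
  have h2 := (weightIdeal R w _).mul_mem_left (P i k) (hQ k j) d hk
  rcases Int.units_eq_one_or σ with rfl | rfl <;>
  · simp only [Units.val_one, Units.val_neg] at h1 h2
    rw [Set.mem_Icc]
    have := le_abs_self C; have := le_abs_self D; have := le_abs_self i; have := le_abs_self j
    have := neg_abs_le C; have := neg_abs_le D; have := neg_abs_le i; have := neg_abs_le j
    constructor <;> omega

theorem fsummable_mul_mul {P Q T : Mat R} {C D E : ℤ}
    (hP : ∀ i j, P i j ∈ weightIdeal R w ((σ : ℤ) * (j - i) - C))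
    (hQ : ∀ i j, Q i j ∈ weightIdeal R w ((σ : ℤ) * (j - i) - D))
    (hT : ∀ i j, T i j ∈ weightIdeal R w ((σ : ℤ) * (j - i) - E)) (i j : ℤ) :
    FSummable fun p : ℤ × ℤ => P i p.2 * Q p.2 p.1 * T p.1 j := by
  intro d
  set N : ℤ := 3 * (Finsupp.weight w d : ℤ) + |C| + |D| + |E| + |i| + |j| with hN
  refine ((Set.finite_Icc (-N) N).prod (Set.finite_Icc (-N) N)).subset fun p hk => ?_
  have h1 := (weightIdeal R w _).mul_mem_right (T p.1 j)
    ((weightIdeal R w _).mul_mem_right (Q p.2 p.1) (hP i p.2)) d hk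
  have h2 := (weightIdeal R w _).mul_mem_right (T p.1 j)
    ((weightIdeal R w _).mul_mem_left (P i p.2) (hQ p.2 p.1)) d hk
  have h3 := (weightIdeal R w _).mul_mem_left (P i p.2 * Q p.2 p.1) (hT p.1 j) d hk
  rcases Int.units_eq_one_or σ with rfl | rfl <;>
  · simp only [Units.val_one, Units.val_neg] at h1 h2 h3
    rw [Set.mem_prod, Set.mem_Icc, Set.mem_Icc]
    have := le_abs_self C; have := le_abs_self D; have := le_abs_self i; have := le_abs_self j
    have := neg_abs_le C; have := neg_abs_le D; have := neg_abs_le i; have := neg_abs_le j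
    have := le_abs_self E; have := neg_abs_le E
    refine ⟨⟨?_, ?_⟩, ⟨?_, ?_⟩⟩ <;> omega

variable [Algebra ℚ R]

theorem mmul_mem {P Q : Mat R} (hP : P ∈ bandSubmodule R w σ) (hQ : Q ∈ bandSubmodule R w σ) :
    mmul P Q ∈ bandSubmodule R w σ := by
  obtain ⟨C, hC⟩ := hP
  obtain ⟨D, hD⟩ := hQ
  refine ⟨C + D, fun i j => fsum_mem_weightIdeal fun k => ?_⟩
  convert mul_mem_weightIdeal (hC i k) (hD k j) using 2
  ring

/-- The matrix `diag[a(s)] Λ^r`, where `Λ = (δ_{j-i,1})`. -/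
def diagShift (a : ℤ → Fn R) (r : ℤ) : Mat R := fun i j => if j = i + r then a i else 0

theorem diagShift_mem (a : ℤ → Fn R) (r : ℤ) : diagShift a r ∈ bandSubmodule R w σ := by
  refine ⟨(σ : ℤ) * r, fun i j => ?_⟩
  unfold diagShift
  split_ifs with h
  · intro d _
    subst h
    have : (σ : ℤ) * (i + r - i) - σ * r = 0 := by ring
    omega
  · exact zero_mem _

/-- The matrices of a fixed type form a ring. -/
instance : Ring (Band R w σ) where
  __ := (inferInstance : AddCommGroup (Band R w σ))
  mul P Q := ⟨mmul P.1 Q.1, mmul_mem P.2 Q.2⟩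
  one := ⟨diagShift (fun _ => 1) 0, diagShift_mem _ _⟩
  zero_mul P := Subtype.ext <| by
    funext i j
    change (fsum fun k => (0 : Fn R) * P.1 k j) = 0
    simp only [zero_mul, fsum_zero]
  mul_zero P := Subtype.ext <| by
    funext i j
    change (fsum fun k => P.1 i k * (0 : Fn R)) = 0
    simp only [mul_zero, fsum_zero]
  one_mul P := Subtype.ext <| by
    funext i j
    change (fsum fun k => diagShift (fun _ => (1 : Fn R)) 0 i k * P.1 k j) = P.1 i j
    rw [fsum_single _ i]
    · simp [diagShift]
    · intro k hk
      simp [diagShift, hk]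
  mul_one P := Subtype.ext <| by
    funext i j
    change (fsum fun k => P.1 i k * diagShift (fun _ => (1 : Fn R)) 0 k j) = P.1 i j
    rw [fsum_single _ j]
    · simp [diagShift]
    · intro k hk
      simp [diagShift, Ne.symm hk]
  left_distrib P Q T := Subtype.ext <| by
    obtain ⟨C, hC⟩ := P.2
    obtain ⟨D, hD⟩ := Q.2
    obtain ⟨E, hE⟩ := T.2
    funext i j
    change (fsum fun k => P.1 i k * (Q.1 k j + T.1 k j)) =
      (fsum fun k => P.1 i k * Q.1 k j) + fsum fun k => P.1 i k * T.1 k j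
    simp only [mul_add]
    exact fsum_add (fsummable_mul hC hD i j) (fsummable_mul hC hE i j)
  right_distrib P Q T := Subtype.ext <| by
    obtain ⟨C, hC⟩ := P.2
    obtain ⟨D, hD⟩ := Q.2
    obtain ⟨E, hE⟩ := T.2
    funext i j
    change (fsum fun k => (P.1 i k + Q.1 i k) * T.1 k j) =
      (fsum fun k => P.1 i k * T.1 k j) + fsum fun k => Q.1 i k * T.1 k j
    simp only [add_mul]
    exact fsum_add (fsummable_mul hC hE i j) (fsummable_mul hD hE i j)
  mul_assoc P Q T := Subtype.ext <| by
    obtain ⟨C, hC⟩ := P.2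
    obtain ⟨D, hD⟩ := Q.2
    obtain ⟨E, hE⟩ := T.2
    funext i j
    change (fsum fun l => (fsum fun k => P.1 i k * Q.1 k l) * T.1 l j) =
      fsum fun k => P.1 i k * fsum fun l => Q.1 k l * T.1 l j
    simp only [fsum_mul (fsummable_mul hC hD _ _), mul_fsum (fsummable_mul hD hE _ _), ← mul_assoc]
    exact fsum_comm (f := fun l k => P.1 i k * Q.1 k l * T.1 l j)
      (fsummable_mul_mul hC hD hE i j)

theorem Band.coe_mul (P Q : Band R w σ) : (P * Q).1 = mmul P.1 Q.1 := rfl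

theorem Band.coe_one : (1 : Band R w σ).1 = diagShift (fun _ => 1) 0 := rfl

end Ring

/-! ### Units: triangular matrices and exponentials -/

section Units

variable {R : Type*} [CommRing R] {w : Times → ℕ} {σ : ℤˣ}

theorem fsum_range (σ : ℤˣ) (f : ℤ → Fn R) (a : ℤ) (n : ℕ)
    (h : ∀ k, f k ≠ 0 → 0 ≤ (σ : ℤ) * (k - a) ∧ (σ : ℤ) * (k - a) ≤ n) :
    fsum f = ∑ m ∈ Finset.range (n + 1), f (a + σ * m) := by
  classical
  have hinj : Set.InjOn (fun m : ℕ => a + (σ : ℤ) * m) (Finset.range (n + 1)) := by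
    intro m _ m' _ hm
    rcases Int.units_eq_one_or σ with rfl | rfl <;> simpa using hm
  rw [← Finset.sum_image (f := f) hinj]
  ext d
  rw [coeff_fsum, map_sum]
  refine finsum_eq_sum_of_support_subset _ fun k hk => ?_
  have hk0 : f k ≠ 0 := fun h0 => hk (by simp [h0])
  obtain ⟨h1, h2⟩ := h k hk0
  rw [Finset.coe_image]
  refine ⟨((σ : ℤ) * (k - a)).toNat, ?_, ?_⟩
  · simp only [Finset.coe_range, Set.mem_Iio]
    omega
  · change a + (σ : ℤ) * (((σ : ℤ) * (k - a)).toNat : ℤ) = k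
    rw [Int.toNat_of_nonneg h1]
    rcases Int.units_eq_one_or σ with rfl | rfl <;> simp

/-- The entries of column `j` of the inverse of a triangular matrix `S`. -/
def invCol (S : Mat R) (σ : ℤˣ) (j : ℤ) : ℕ → Fn R
  | 0 => Ring.inverse (S j j)
  | n + 1 => -Ring.inverse (S (j + σ * (n + 1 : ℕ)) (j + σ * (n + 1 : ℕ))) *
      ∑ k : Fin (n + 1), S (j + σ * (n + 1 : ℕ)) (j + σ * (k : ℕ)) * invCol S σ j k

theorem exists_right_inverse {S : Mat R} (hS : ∀ i j, 0 < (σ : ℤ) * (j - i) → S i j = 0)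
    (hd : ∀ i, IsUnit (S i i)) :
    ∃ T : Mat R, (∀ i j, 0 < (σ : ℤ) * (j - i) → T i j = 0) ∧ (∀ i, IsUnit (T i i)) ∧
      mmul S T = diagShift (fun _ => 1) 0 := by
  refine ⟨fun i j => if 0 ≤ (σ : ℤ) * (i - j) then invCol S σ j ((σ : ℤ) * (i - j)).toNat else 0,
    ?_, ?_, ?_⟩
  · intro i j h
    have : (σ : ℤ) * (i - j) = -(σ * (j - i)) := by ring
    exact if_neg (by omega)
  · intro i
    simp [invCol, hd i]
  · funext i j
    have hs : (σ : ℤ) * σ = 1 := by rcases Int.units_eq_one_or σ with rfl | rfl <;> simp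
    by_cases hij : 0 ≤ (σ : ℤ) * (i - j)
    · obtain ⟨n, hn⟩ := Int.eq_ofNat_of_zero_le hij
      have hi : i = j + σ * n := by
        rw [← hn, ← mul_assoc, hs]; ring
      have key : mmul S (fun i j => if 0 ≤ (σ : ℤ) * (i - j) then
          invCol S σ j ((σ : ℤ) * (i - j)).toNat else 0) i j =
          ∑ m ∈ Finset.range (n + 1), S i (j + σ * m) * invCol S σ j m := by
        unfold mmul
        rw [fsum_range σ _ j n]
        · refine Finset.sum_congr rfl fun m _ => ?_
          have : (σ : ℤ) * (j + σ * m - j) = m := by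
            rw [add_sub_cancel_left, ← mul_assoc, hs, one_mul]
          simp only [this, Int.toNat_natCast, Nat.cast_nonneg, if_true]
        · intro k hk
          constructor
          · by_contra hc
            exact hk (by simp only [if_neg hc, mul_zero])
          · by_contra hc
            have : (σ : ℤ) * (k - i) = σ * (k - j) - σ * (i - j) := by ring
            have h0 : S i k = 0 := hS i k (by omega)
            exact hk (by simp only [h0, zero_mul])
      rw [key]
      cases n with
      | zero =>
        have : i = j := by simpa using hi
        subst this
        simp [invCol, diagShift, Ring.mul_inverse_cancel _ (hd i)]
      | succ n =>
        have hne : j ≠ i := by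
          rintro rfl
          simp at hn
          omega
        rw [Finset.sum_range_succ, invCol, ← hi, neg_mul, mul_neg, ← mul_assoc,
          Ring.mul_inverse_cancel _ (hd i), one_mul, Finset.sum_range, add_neg_cancel]
        simp [diagShift, hne]
    · have hne : j ≠ i := by
        rintro rfl
        simp at hij
      have : ∀ k, S i k * (if 0 ≤ (σ : ℤ) * (k - j) then
          invCol S σ j ((σ : ℤ) * (k - j)).toNat else 0) = 0 := by
        intro k
        split_ifs with h
        · rw [hS i k, zero_mul]
          have : (σ : ℤ) * (k - i) = σ * (k - j) - σ * (i - j) := by ring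
          omega
        · rw [mul_zero]
      simp only [mmul, this, fsum_zero, diagShift, add_zero, if_neg hne]

/-- The matrix `f(Λ^σ) = ∑_{k ≥ 0} f_k Λ^{σ k}` for a power series `f = ∑_k f_k z^k`. -/
def toeplitz (σ : ℤˣ) (f : PowerSeries (Fn R)) : Mat R := fun i j =>
  if 0 ≤ (σ : ℤ) * (j - i) then PowerSeries.coeff ((σ : ℤ) * (j - i)).toNat f else 0

/-- The power series `f = ∑_k f_k z^k` such that `f_k` has `w`-weight at least `k`. -/
def weightedSeries (R : Type*) [CommRing R] (w : Times → ℕ) : Subring (PowerSeries (Fn R)) where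
  carrier := {f | ∀ k : ℕ, PowerSeries.coeff k f ∈ weightIdeal R w k}
  zero_mem' := fun k => by simp
  one_mem' := fun k => by
    rw [PowerSeries.coeff_one]
    split_ifs with h
    · subst h
      intro d _
      simp
    · exact zero_mem _
  add_mem' := fun hf hg k => by
    rw [map_add]
    exact add_mem (hf k) (hg k)
  neg_mem' := fun hf k => by
    rw [map_neg]
    exact neg_mem (hf k)
  mul_mem' := fun {f g} hf hg k => by
    rw [PowerSeries.coeff_mul]
    refine sum_mem fun p hp => ?_
    have := mul_mem_weightIdeal (hf p.1) (hg p.2)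
    rwa [← Nat.cast_add, Finset.HasAntidiagonal.mem_antidiagonal.1 hp] at this

theorem toeplitz_mul (f g : PowerSeries (Fn R)) :
    mmul (toeplitz σ f) (toeplitz σ g) = toeplitz σ (f * g) := by
  funext i j
  have hs : (σ : ℤ) * σ = 1 := by rcases Int.units_eq_one_or σ with rfl | rfl <;> simp
  have hsub : ∀ k, (σ : ℤ) * (j - i) = σ * (k - i) + σ * (j - k) := fun k => by ring
  by_cases hij : 0 ≤ (σ : ℤ) * (j - i)
  · obtain ⟨n, hn⟩ := Int.eq_ofNat_of_zero_le hij
    rw [mmul, fsum_range σ _ i n]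
    · simp only [toeplitz, hn, Int.toNat_natCast]
      rw [PowerSeries.coeff_mul, Finset.Nat.sum_antidiagonal_eq_sum_range_succ
        (fun a b => PowerSeries.coeff a f * PowerSeries.coeff b g)]
      refine Finset.sum_congr rfl fun m hm => ?_
      have hm' : m ≤ n := by
        have := Finset.mem_range.1 hm
        omega
      have h1 : (σ : ℤ) * (i + σ * m - i) = m := by
        rw [add_sub_cancel_left, ← mul_assoc, hs, one_mul]
      have h2 : (σ : ℤ) * (j - (i + σ * m)) = (n - m : ℕ) := by
        have := hsub (i + σ * m)
        push_cast [hm']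
        omega
      rw [h1, h2]
      simp
    · intro k hk
      have h := hsub k
      constructor
      · by_contra hc
        exact hk (by simp [toeplitz, hc])
      · by_contra hc
        refine hk ?_
        have : ¬ 0 ≤ (σ : ℤ) * (j - k) := by omega
        simp only [toeplitz, if_neg this, mul_zero]
  · have : ∀ k, toeplitz σ f i k * toeplitz σ g k j = 0 := by
      intro k
      have h := hsub k
      unfold toeplitz
      split_ifs with h1 h2
      · omega
      · rw [mul_zero]
      · rw [zero_mul]
      · rw [zero_mul]
    rw [mmul, toeplitz, if_neg hij, ← fsum_zero (R := R) (ι := ℤ)]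
    exact congrArg fsum (funext this)

theorem toeplitz_one : toeplitz σ (1 : PowerSeries (Fn R)) = diagShift (fun _ => 1) 0 := by
  funext i j
  unfold toeplitz diagShift
  rcases Int.units_eq_one_or σ with rfl | rfl <;>
  · simp only [PowerSeries.coeff_one, Units.val_one, Units.val_neg]
    split_ifs <;> first | rfl | omega

/-- The power series `ξ(t, z) = ∑_{n ≥ 1} t_n z^n`. -/
def xi (R : Type*) [CommRing R] (t : ℕ+ → Times) : PowerSeries (Fn R) :=
  PowerSeries.mk fun n => if h : 0 < n then MvPowerSeries.X (t ⟨n, h⟩) else 0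

theorem hasSubst_xi (t : ℕ+ → Times) : PowerSeries.HasSubst (xi R t) :=
  PowerSeries.HasSubst.of_constantCoeff_zero' (by
    rw [← PowerSeries.coeff_zero_eq_constantCoeff_apply, xi, PowerSeries.coeff_mk]
    simp)

theorem subst_xi_mem {t : ℕ+ → Times} (ht : ∀ n, w (t n) = n) (f : PowerSeries (Fn R)) :
    PowerSeries.subst (xi R t) f ∈ weightedSeries R w := by
  have hxi : xi R t ∈ weightedSeries R w := by
    intro k
    rw [xi, PowerSeries.coeff_mk]
    split_ifs with h
    · intro d hd
      classical
      rw [MvPowerSeries.coeff_X] at hd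
      have : d = Finsupp.single (t ⟨k, h⟩) 1 := by
        by_contra hc
        exact hd (if_neg hc)
      subst this
      have := ht ⟨k, h⟩
      simp only [Finsupp.weight_single]
      simp [this]
    · exact zero_mem _
  intro k
  rw [PowerSeries.coeff_subst' (hasSubst_xi t)]
  exact finsum_induction (· ∈ weightIdeal R w k) (zero_mem _) (fun _ _ => add_mem)
    fun n => Ideal.mul_mem_left _ _ ((weightedSeries R w).pow_mem hxi n k)

variable [Algebra ℚ R]

theorem triangular_mem {S : Mat R} (hS : ∀ i j, 0 < (σ : ℤ) * (j - i) → S i j = 0) :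
    S ∈ bandSubmodule R w σ := by
  refine ⟨0, fun i j => ?_⟩
  by_cases h : 0 < (σ : ℤ) * (j - i)
  · rw [hS i j h]
    exact zero_mem _
  · intro d _
    omega

/-- A triangular matrix with invertible diagonal entries is invertible. -/
theorem isUnit_triangular {S : Mat R} (hS : ∀ i j, 0 < (σ : ℤ) * (j - i) → S i j = 0)
    (hd : ∀ i, IsUnit (S i i)) :
    IsUnit (⟨S, triangular_mem hS⟩ : Band R w σ) := by
  obtain ⟨T, hT, hTd, hST⟩ := exists_right_inverse hS hd
  obtain ⟨U, hU, _, hTU⟩ := exists_right_inverse hT hTd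
  have h1 : (⟨S, triangular_mem hS⟩ : Band R w σ) * ⟨T, triangular_mem hT⟩ = 1 := Subtype.ext hST
  have h2 : (⟨T, triangular_mem hT⟩ : Band R w σ) * ⟨U, triangular_mem hU⟩ = 1 := Subtype.ext hTU
  have h3 : (⟨S, triangular_mem hS⟩ : Band R w σ) = ⟨U, triangular_mem hU⟩ := by
    rw [← mul_one (⟨S, triangular_mem hS⟩ : Band R w σ), ← h2, ← mul_assoc, h1, one_mul]
  exact ⟨⟨_, _, h1, by rw [h3, h2]⟩, rfl⟩

theorem toeplitz_mem {f : PowerSeries (Fn R)} (hf : f ∈ weightedSeries R w) :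
    toeplitz σ f ∈ bandSubmodule R w σ := by
  refine ⟨0, fun i j => ?_⟩
  unfold toeplitz
  split_ifs with h
  · have := hf ((σ : ℤ) * (j - i)).toNat
    rw [Int.toNat_of_nonneg h] at this
    rwa [sub_zero]
  · exact zero_mem _

/-- The invertible matrix `e^{ξ(t, Λ^σ)}`. -/
def expXi (σ : ℤˣ) (t : ℕ+ → Times) (ht : ∀ n, w (t n) = n) : (Band R w σ)ˣ where
  val := ⟨toeplitz σ (PowerSeries.subst (xi R t) (PowerSeries.exp (Fn R))),
    toeplitz_mem (subst_xi_mem ht _)⟩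
  inv := ⟨toeplitz σ (PowerSeries.subst (xi R t)
    (PowerSeries.evalNegHom (PowerSeries.exp (Fn R)))), toeplitz_mem (subst_xi_mem ht _)⟩
  val_inv := Subtype.ext <| by
    change mmul _ _ = diagShift _ _
    rw [toeplitz_mul, ← PowerSeries.subst_mul (hasSubst_xi t), PowerSeries.exp_mul_exp_neg_eq_one,
      ← PowerSeries.coe_substAlgHom (hasSubst_xi t), map_one, toeplitz_one]
  inv_val := Subtype.ext <| by
    change mmul _ _ = diagShift _ _
    rw [toeplitz_mul, ← PowerSeries.subst_mul (hasSubst_xi t), mul_comm,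
      PowerSeries.exp_mul_exp_neg_eq_one,
      ← PowerSeries.coe_substAlgHom (hasSubst_xi t), map_one, toeplitz_one]

/-- The invertible matrix `Λ = (δ_{j-i,1})`, with inverse `Λ^{-1}`. -/
def shift : (Band R w σ)ˣ where
  val := ⟨diagShift (fun _ => 1) 1, diagShift_mem _ _⟩
  inv := ⟨diagShift (fun _ => 1) (-1), diagShift_mem _ _⟩
  val_inv := Subtype.ext <| by
    funext i j
    change (fsum fun k => diagShift (fun _ => 1) 1 i k * diagShift (fun _ => 1) (-1) k j) = _
    rw [fsum_single _ (i + 1) fun k hk => by simp [diagShift, hk]]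
    simp [Band.coe_one, diagShift]
  inv_val := Subtype.ext <| by
    funext i j
    change (fsum fun k => diagShift (fun _ => 1) (-1) i k * diagShift (fun _ => 1) 1 k j) = _
    rw [fsum_single _ (i + -1) fun k hk => by simp [diagShift, hk]]
    simp [Band.coe_one, diagShift]

end Units

/-! ### Wave matrices and the Toda lattice hierarchy -/

section Toda

variable {R : Type*} [CommRing R]

/-- The weight with `x_n` of weight `n` and `y_n` of weight `0`. -/
def xWeight : Times → ℕ := Sum.elim (fun n => (n : ℕ)) fun _ => 0

/-- The weight with `y_n` of weight `n` and `x_n` of weight `0`. -/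
def yWeight : Times → ℕ := Sum.elim (fun _ => 0) fun n => (n : ℕ)

/-- The matrices in which `W_1`, `L_1`, `M_1` live: the lower part is arbitrary, and the entries
tend to `0` (in `x`-weight) away from the diagonal in the upper part. -/
abbrev Alg₁ (R : Type*) [CommRing R] [Algebra ℚ R] : Type _ := Band R xWeight 1

/-- The matrices in which `W_2`, `L_2`, `M_2` live: the upper part is arbitrary, and the entries
tend to `0` (in `y`-weight) away from the diagonal in the lower part. -/
abbrev Alg₂ (R : Type*) [CommRing R] [Algebra ℚ R] : Type _ := Band R yWeight (-1)

/-- The upper triangular part `P_u`, including the diagonal. -/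
def upperPart (P : Mat R) : Mat R := fun i j => if i ≤ j then P i j else 0

/-- The strictly lower triangular part `P_l`. -/
def lowerPart (P : Mat R) : Mat R := fun i j => if j < i then P i j else 0

/-- `P_+ = P_{1u} + P_{2l}`, the common value of both components of `(P_1, P_2)_+`. -/
def plusPart (P : Mat R × Mat R) : Mat R := upperPart P.1 + lowerPart P.2

/-- `∂_v P`, entry by entry. -/
def partialMat (v : Times) (P : Mat R) : Mat R := fun i j => partialT v (P i j)

variable [Algebra ℚ R]

theorem lowerPart_mem (P : Mat R) : lowerPart P ∈ bandSubmodule R xWeight 1 :=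
  triangular_mem fun i j h => if_neg (by simp at h; omega)

theorem upperPart_mem (P : Mat R) : upperPart P ∈ bandSubmodule R yWeight (-1) :=
  triangular_mem fun i j h => if_neg (by simp at h; omega)

/-- `(P_1, P_2)_- = (P_{1l} - P_{2l}, P_{2u} - P_{1u})`. -/
def minusPart (P : Mat R × Mat R) : Alg₁ R × Alg₂ R :=
  (⟨lowerPart P.1, lowerPart_mem _⟩ - ⟨lowerPart P.2, lowerPart_mem _⟩,
    ⟨upperPart P.2, upperPart_mem _⟩ - ⟨upperPart P.1, upperPart_mem _⟩)

/-- The dressing matrices `S_1 = ∑_{i ≥ 0} diag[c_i(s)] Λ^{-i}` with `c_0 = 1` and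
`S_2 = ∑_{i ≥ 0} diag[c'_i(s)] Λ^i` with `c'_0(s)` invertible for all `s`. -/
structure Dressing (R : Type*) [CommRing R] where
  S₁ : Mat R
  S₂ : Mat R
  S₁_lower : ∀ i j, i < j → S₁ i j = 0
  S₁_diag : ∀ i, S₁ i i = 1
  S₂_upper : ∀ i j, j < i → S₂ i j = 0
  S₂_diag : ∀ i, IsUnit (S₂ i i)

/-- `ε = diag[s] Λ^{-1}`. -/
def eps (R : Type*) [CommRing R] : Mat R := diagShift (fun s => (s : Fn R)) (-1)

/-- `ε* = -ε^T + Λ`. -/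
def epsStar (R : Type*) [CommRing R] : Mat R := -(eps R).transpose + diagShift (fun _ => 1) 1

theorem epsStar_mem : epsStar R ∈ bandSubmodule R yWeight (-1) := by
  refine add_mem (neg_mem ?_) (diagShift_mem _ _)
  have : (eps R).transpose = diagShift (fun s => ((s + 1 : ℤ) : Fn R)) 1 := by
    funext i j
    simp only [Matrix.transpose_apply, eps, diagShift]
    by_cases h : j = i + 1
    · subst h
      simp
    · rw [if_neg h, if_neg (by omega)]
  rw [this]
  exact diagShift_mem _ _

namespace Dressing

/-- `S_1` as an invertible matrix. -/
def unit₁ (D : Dressing R) : (Alg₁ R)ˣ :=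
  (isUnit_triangular (w := xWeight) (σ := 1) (S := D.S₁)
    (fun i j h => D.S₁_lower i j (by simp at h; omega))
    (fun i => by rw [D.S₁_diag i]; exact isUnit_one)).unit

/-- `S_2` as an invertible matrix. -/
def unit₂ (D : Dressing R) : (Alg₂ R)ˣ :=
  (isUnit_triangular (w := yWeight) (σ := -1) (S := D.S₂)
    (fun i j h => D.S₂_upper i j (by simp at h; omega)) D.S₂_diag).unit

/-- The wave matrix `W_1 = S_1 e^{ξ(x, Λ)}`. -/
def W₁ (D : Dressing R) : (Alg₁ R)ˣ := D.unit₁ * expXi 1 Sum.inl fun _ => rfl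

/-- The wave matrix `W_2 = S_2 e^{ξ(y, Λ^{-1})}`. -/
def W₂ (D : Dressing R) : (Alg₂ R)ˣ := D.unit₂ * expXi (-1) Sum.inr fun _ => rfl

/-- The pair `W = (W_1, W_2)`. -/
def W (D : Dressing R) : Alg₁ R × Alg₂ R := (D.W₁, D.W₂)

/-- The Lax matrix `L_1 = W_1 Λ W_1^{-1}`. -/
def L₁ (D : Dressing R) : (Alg₁ R)ˣ := D.W₁ * shift * D.W₁⁻¹

/-- The Lax matrix `L_2 = W_2 Λ^{-1} W_2^{-1}`. -/
def L₂ (D : Dressing R) : (Alg₂ R)ˣ := D.W₂ * shift⁻¹ * D.W₂⁻¹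

/-- The Orlov–Shulman matrix `M_1 = W_1 ε W_1^{-1}`. -/
def M₁ (D : Dressing R) : Alg₁ R := D.W₁ * ⟨eps R, diagShift_mem _ _⟩ * (D.W₁⁻¹ : (Alg₁ R)ˣ)

/-- The Orlov–Shulman matrix `M_2 = W_2 ε* W_2^{-1}`. -/
def M₂ (D : Dressing R) : Alg₂ R := D.W₂ * ⟨epsStar R, epsStar_mem⟩ * (D.W₂⁻¹ : (Alg₂ R)ˣ)

/-- The matrix `L_1^n` for an integer `n`. -/
def L₁pow (D : Dressing R) (n : ℤ) : Alg₁ R := ((D.L₁ ^ n : (Alg₁ R)ˣ) : Alg₁ R)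

/-- The matrix `L_2^n` for an integer `n`. -/
def L₂pow (D : Dressing R) (n : ℤ) : Alg₂ R := ((D.L₂ ^ n : (Alg₂ R)ˣ) : Alg₂ R)

/-- The wave matrices solve the Toda lattice hierarchy:
`∂_{x_n} W = (L_1^n, 0)_+ W` and `∂_{y_n} W = (0, L_2^n)_+ W`. -/
structure IsToda (D : Dressing R) : Prop where
  x_W₁ : ∀ n : ℕ+, partialMat (Sum.inl n) D.W.1.1 = mmul (plusPart ((D.L₁pow n).1, 0)) D.W.1.1
  x_W₂ : ∀ n : ℕ+, partialMat (Sum.inl n) D.W.2.1 = mmul (plusPart ((D.L₁pow n).1, 0)) D.W.2.1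
  y_W₁ : ∀ n : ℕ+, partialMat (Sum.inr n) D.W.1.1 = mmul (plusPart (0, (D.L₂pow n).1)) D.W.1.1
  y_W₂ : ∀ n : ℕ+, partialMat (Sum.inr n) D.W.2.1 = mmul (plusPart (0, (D.L₂pow n).1)) D.W.2.1

end Dressing

/-! ### Formal series in the spectral parameters -/

/-- Formal series `∑_{k ∈ ℤ} f_k z^k`, infinite in both directions. -/
abbrev Series (R : Type*) : Type _ := ℤ → Fn R

/-- The series `f(z^{-1})`. -/
def Series.inv {R : Type*} (f : Series R) : Series R := fun k => f (-k)

/-- The series `z^{-1} f(z)`. -/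
def Series.divVar {R : Type*} (f : Series R) : Series R := fun k => f (k + 1)

/-- Formal double series `∑_{m ≥ 0} ∑_{n ∈ ℤ} F_{m,n} (μ - λ)^m λ^n`. -/
abbrev DoubleSeries (V : Type*) : Type _ := ℕ → ℤ → V

/-- The double series of `f(μ) = ∑_k f_k (λ + (μ - λ))^k = ∑_k f_k ∑_m C(k, m) (μ - λ)^m λ^{k-m}`,
that is, of `e^{(μ - λ) ∂_λ} f(λ)`. -/
def Series.taylor {R : Type*} [CommRing R] (f : Series R) : DoubleSeries (Fn R) := fun m n =>
  Ring.choose (n + m) m • f (n + m)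

/-- The vector `χ(z) = (z^i)_{i ∈ ℤ}`. -/
def chi (R : Type*) [CommRing R] : ℤ → Series R := fun i k => if k = i then 1 else 0

/-- The vector `χ*(z) = χ(z^{-1})`. -/
def chiStar (R : Type*) [CommRing R] : ℤ → Series R := fun i => (chi R i).inv

/-- The product `P v` of a matrix and a vector of series. -/
def mulVec {R : Type*} [CommRing R] (P : Mat R) (v : ℤ → Series R) : ℤ → Series R := fun i k =>
  fsum fun j => P i j * v j k

/-- The entry `(i, j)` of `q(μ) ⊗ r(λ)`: the coefficient of `(μ - λ)^m λ^n` in `q_i(μ) r_j(λ)`. -/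
def kronecker {R : Type*} [CommRing R] (q r : ℤ → Series R) : DoubleSeries (Mat R) :=
  fun m n i j => fsum fun k => (q i).taylor m k * r j (n - k)

/-- All the sums in `q(μ) ⊗ r(λ)` make sense. -/
def KroneckerSummable {R : Type*} [CommRing R] (q r : ℤ → Series R) : Prop :=
  ∀ (m : ℕ) (n i j : ℤ), FSummable fun k => (q i).taylor m k * r j (n - k)

/-- The double series `λ^{-1} F`. -/
def DoubleSeries.divLam {V : Type*} (F : DoubleSeries V) : DoubleSeries V := fun m n => F m (n + 1)

/-- The double series
`∑_{m ≥ 0} (μ - λ)^m / m! ∑_{l ∈ ℤ} λ^{-l-m-1} F_{m,l}`. -/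
def genSeries {V : Type*} [AddCommGroup V] [Module ℚ V] (F : ℕ → ℤ → V) : DoubleSeries V :=
  fun m n => ((m.factorial : ℚ)⁻¹) • F m (-n - m - 1)

namespace Dressing

/-- The wave function `Ψ_1(z) = W_1 χ(z)`. -/
def Ψ₁ (D : Dressing R) : ℤ → Series R := mulVec D.W.1.1 (chi R)

/-- The wave function `Ψ_2(z) = W_2 χ(z)`. -/
def Ψ₂ (D : Dressing R) : ℤ → Series R := mulVec D.W.2.1 (chi R)

/-- The adjoint wave function `Ψ_1*(z) = (W_1^{-1})^T χ*(z)`. -/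
def Ψ₁star (D : Dressing R) : ℤ → Series R :=
  mulVec (D.W₁⁻¹ : (Alg₁ R)ˣ).1.1.transpose (chiStar R)

/-- The adjoint wave function `Ψ_2*(z) = (W_2^{-1})^T χ*(z)`. -/
def Ψ₂star (D : Dressing R) : ℤ → Series R :=
  mulVec (D.W₂⁻¹ : (Alg₂ R)ˣ).1.1.transpose (chiStar R)

/-- `q` is a vector eigenfunction:
`∂_{x_n} q = (L_1^n)_u q` and `∂_{y_n} q = (L_2^n)_l q`. -/
structure IsEigenfunction (D : Dressing R) (q : ℤ → Series R) : Prop where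
  x : ∀ (n : ℕ+) (i k : ℤ), partialT (Sum.inl n) (q i k) = mulVec (upperPart (D.L₁pow n).1) q i k
  y : ∀ (n : ℕ+) (i k : ℤ), partialT (Sum.inr n) (q i k) = mulVec (lowerPart (D.L₂pow n).1) q i k

/-- `r` is a vector adjoint eigenfunction:
`∂_{x_n} r = -((L_1^n)_u)^T r` and `∂_{y_n} r = -((L_2^n)_l)^T r`. -/
structure IsAdjointEigenfunction (D : Dressing R) (r : ℤ → Series R) : Prop where
  x : ∀ (n : ℕ+) (i k : ℤ),
    partialT (Sum.inl n) (r i k) = -mulVec (upperPart (D.L₁pow n).1).transpose r i k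
  y : ∀ (n : ℕ+) (i k : ℤ),
    partialT (Sum.inr n) (r i k) = -mulVec (lowerPart (D.L₂pow n).1).transpose r i k

/-- The generating series `Y_1(λ, μ)` of the matrices `M_1^m L_1^{m+l}`. -/
def Y₁ (D : Dressing R) : DoubleSeries (Alg₁ R) := genSeries fun m l => D.M₁ ^ m * D.L₁pow (m + l)

/-- The generating series `Y_2(λ, μ)` of the matrices `M_2^m L_2^{m+l}`. -/
def Y₂ (D : Dressing R) : DoubleSeries (Alg₂ R) := genSeries fun m l => D.M₂ ^ m * D.L₂pow (m + l)

/-- The additional flow `∂_{x*_{m,l}} W = -(M_1^m L_1^l, 0)_- W`. -/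
def addFlowX (D : Dressing R) (m : ℕ) (l : ℤ) : Alg₁ R × Alg₂ R :=
  -(minusPart ((D.M₁ ^ m * D.L₁pow l).1, 0) * D.W)

/-- The additional flow `∂_{y*_{m,l}} W = -(0, M_2^m L_2^l)_- W`. -/
def addFlowY (D : Dressing R) (m : ℕ) (l : ℤ) : Alg₁ R × Alg₂ R :=
  -(minusPart (0, (D.M₂ ^ m * D.L₂pow l).1) * D.W)

/-- The squared eigenfunction flow `∂_α W = (q ⊗ r, 0)_- W` of `q(μ)` and `r(λ)`, that is,
`∂_α W_1 = (q ⊗ r)_l W_1` and `∂_α W_2 = -(q ⊗ r)_u W_2`. -/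
def sqFlow (D : Dressing R) (q r : ℤ → Series R) : DoubleSeries (Alg₁ R × Alg₂ R) :=
  fun m n => minusPart (kronecker q r m n, 0) * D.W

/-- The vector `λ^{-1} Ψ_1*(λ)`. -/
def r₁ (D : Dressing R) : ℤ → Series R := fun i => (D.Ψ₁star i).divVar

/-- The vector `-Ψ_2(μ^{-1})`. -/
def q₂ (D : Dressing R) : ℤ → Series R := fun i => -(D.Ψ₂ i).inv

/-- The vector `λ^{-1} Ψ_2*(λ^{-1})`. -/
def r₂ (D : Dressing R) : ℤ → Series R := fun i => (D.Ψ₂star i).inv.divVar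

/-- The double series `λ^{-1} Ψ_1(μ) ⊗ Ψ_1*(λ)`. -/
def kernel₁ (D : Dressing R) : DoubleSeries (Mat R) := (kronecker D.Ψ₁ D.Ψ₁star).divLam

/-- The double series `λ^{-1} Ψ_2(μ^{-1}) ⊗ Ψ_2*(λ^{-1})`. -/
def kernel₂ (D : Dressing R) : DoubleSeries (Mat R) :=
  (kronecker (fun i => (D.Ψ₂ i).inv) fun i => (D.Ψ₂star i).inv).divLam

/-- The flow `∂_{α_1} W_1 = (λ^{-1} Ψ_1(μ) ⊗ Ψ_1*(λ))_l W_1`,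
`∂_{α_1} W_2 = -(λ^{-1} Ψ_1(μ) ⊗ Ψ_1*(λ))_u W_2`. -/
def alphaFlow₁ (D : Dressing R) : DoubleSeries (Alg₁ R × Alg₂ R) := fun m n =>
  (⟨lowerPart (D.kernel₁ m n), lowerPart_mem _⟩ * D.W.1,
    -(⟨upperPart (D.kernel₁ m n), upperPart_mem _⟩ * D.W.2))

/-- The flow `∂_{α_2} W_1 = -(λ^{-1} Ψ_2(μ^{-1}) ⊗ Ψ_2*(λ^{-1}))_l W_1`,
`∂_{α_2} W_2 = (λ^{-1} Ψ_2(μ^{-1}) ⊗ Ψ_2*(λ^{-1}))_u W_2`. -/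
def alphaFlow₂ (D : Dressing R) : DoubleSeries (Alg₁ R × Alg₂ R) := fun m n =>
  (-(⟨lowerPart (D.kernel₂ m n), lowerPart_mem _⟩ * D.W.1),
    ⟨upperPart (D.kernel₂ m n), upperPart_mem _⟩ * D.W.2)

end Dressing

end Toda

end Toda

end

/-! Everything reduces to one computation with matrices having a single nonzero diagonal. In
$M_1^mL_1^l$ the inner wave matrices cancel, leaving $W_1\varepsilon^m\Lambda^lW_1^{-1}$. Pushing
shifts past diagonals gives
$\varepsilon^m=\mathrm{diag}[s(s-1)\cdots(s-m+1)]\Lambda^{-m}=m!\,\mathrm{diag}\big[\binom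
sm\big]\Lambda^{-m}$ (`Band.diag_pow`). The factor $1/m!$ in $Y_1$ removes the factorial, and each
coefficient of $Y_1$ is $W_1\,\mathrm{diag}\big[\binom sm\big]\Lambda^rW_1^{-1}$, with entries
$\sum_s\binom sm(W_1)_{is}(W_1^{-1})_{s+r,j}$.

The Kronecker product has the same summands: $\Psi_1(\mu)_i=\sum_s(W_1)_{is}\mu^s$, the Taylor
expansion of $\mu^s$ supplies $\binom sm\lambda^{s-m}$, and
$\Psi_1^*(\lambda)_j=\sum_t(W_1^{-1})_{tj}\lambda^{-t}$. Fixing the power of $\lambda$ fixes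
$t-s=r$. For the second family $\varepsilon^*=\mathrm{diag}[-s]\Lambda$, and $\binom{-s}m$ is the
Taylor coefficient of $\mu^{-s}$. Convergence comes for free: these are sums computing products in
the rings `Band`, where the weights bound the index from both sides (`kronecker₁_term`,
`kronecker₂_term`).

The eigenfunction equations are the Toda equations read column by column; the adjoint ones follow
from $\partial(W^{-1})=-W^{-1}(\partial W)W^{-1}$ (`Band.partial_inv`). The statements on flows then
use only the linearity of $P\mapsto P_-$ and the fact that $(P_1,P_2)_-$ depends on $P_1-P_2$ alone.
-/

namespace Toda

open scoped Nat

/-! ### Formal sums and partial derivatives of power series -/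

section Sums

variable {R : Type*} [CommRing R] {ι κ : Type*}

theorem fsum_neg (f : ι → Fn R) : (fsum fun i => -f i) = -fsum f := by
  ext d
  simp only [coeff_fsum, map_neg]
  exact finsum_neg_distrib _

theorem fsum_comp_equiv (e : ι ≃ κ) (f : κ → Fn R) : (fsum fun i => f (e i)) = fsum f := by
  ext d
  exact finsum_comp_equiv (f := fun k => MvPowerSeries.coeff d (f k)) e

theorem FSummable.comp_equiv {f : κ → Fn R} (hf : FSummable f) (e : ι ≃ κ) :
    FSummable fun i => f (e i) := fun d =>
  Set.Finite.preimage (f := e) e.injective.injOn (hf d)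

theorem coeff_partialT (v : Times) (f : Fn R) (d : Times →₀ ℕ) :
    MvPowerSeries.coeff d (partialT v f) =
      MvPowerSeries.coeff (d + Finsupp.single v 1) f * (d v + 1) :=
  MvPowerSeries.coeff_pderiv f d

theorem partialT_mul (v : Times) (f g : Fn R) :
    partialT v (f * g) = partialT v f * g + f * partialT v g := by
  unfold partialT
  rw [Derivation.leibniz, smul_eq_mul, smul_eq_mul]
  ring

theorem partialT_zero (v : Times) : partialT v (0 : Fn R) = 0 := map_zero _

theorem partialT_one (v : Times) : partialT v (1 : Fn R) = 0 := Derivation.map_one_eq_zero _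

theorem partialT_neg (v : Times) (f : Fn R) : partialT v (-f) = -partialT v f := map_neg _ _

/-- Each coefficient of a derivative is a constant multiple of a single coefficient of the function,
so no interchange of infinite sums is involved. -/
theorem partialT_fsum (v : Times) {f : ι → Fn R} (hf : FSummable f) :
    partialT v (fsum f) = fsum fun i => partialT v (f i) := by
  ext d
  rw [coeff_partialT, coeff_fsum, coeff_fsum]
  simp only [coeff_partialT]
  exact finsum_mul' _ _ (hf _)

theorem FSummable.partialT {f : ι → Fn R} (hf : FSummable f) (v : Times) :
    FSummable fun i => partialT v (f i) := by
  intro d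
  refine (hf (d + Finsupp.single v 1)).subset fun i hi hc => hi ?_
  have hc' : MvPowerSeries.coeff (d + Finsupp.single v 1) (f i) = 0 := hc
  simp only [coeff_partialT, hc', zero_mul]

/-- A monomial of the derivative comes from one with one more factor $v$, so the weight drops by
exactly `w v`. The loss is uniform over matrix entries, hence differentiation preserves `Band`. -/
theorem partialT_mem_weightIdeal {w : Times → ℕ} {k : ℤ} {f : Fn R} (v : Times)
    (hf : f ∈ weightIdeal R w k) : partialT v f ∈ weightIdeal R w (k - w v) := by
  intro d hd
  rw [coeff_partialT] at hd
  have := hf _ (left_ne_zero_of_mul hd)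
  simp only [map_add, Finsupp.weight_single, one_smul] at this
  push_cast at this
  omega

end Sums

/-! ### The derivations `∂_v` of the rings of matrices -/

section Derivation

variable {R : Type*} [CommRing R] [Algebra ℚ R] {w : Times → ℕ} {σ : ℤˣ}

theorem partialMat_mem (v : Times) {P : Mat R} (hP : P ∈ bandSubmodule R w σ) :
    partialMat v P ∈ bandSubmodule R w σ := by
  obtain ⟨C, hC⟩ := hP
  refine ⟨C + w v, fun i j => ?_⟩
  have := partialT_mem_weightIdeal v (hC i j)
  rwa [sub_sub] at this

/-- `∂_v P` as an element of the ring of matrices. -/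
noncomputable def Band.partial (v : Times) (P : Band R w σ) : Band R w σ :=
  ⟨partialMat v P.1, partialMat_mem v P.2⟩

theorem Band.partial_mul (v : Times) (P Q : Band R w σ) :
    (P * Q).partial v = P.partial v * Q + P * Q.partial v := by
  obtain ⟨C, hC⟩ := P.2
  obtain ⟨D, hD⟩ := Q.2
  obtain ⟨C', hC'⟩ := (P.partial v).2
  obtain ⟨D', hD'⟩ := (Q.partial v).2
  refine Subtype.ext ?_
  funext i j
  change partialT v (fsum fun k => P.1 i k * Q.1 k j) =
    (fsum fun k => partialT v (P.1 i k) * Q.1 k j) + fsum fun k => P.1 i k * partialT v (Q.1 k j)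
  -- Splitting the Leibniz sum requires both halves to be summable; this is where the bounds for the
  -- differentiated factors enter.
  rw [partialT_fsum v (fsummable_mul hC hD i j), ← fsum_add]
  · simp only [partialT_mul]
  · exact fsummable_mul hC' hD i j
  · exact fsummable_mul hC hD' i j

theorem Band.partial_one (v : Times) : (1 : Band R w σ).partial v = 0 := by
  refine Subtype.ext ?_
  funext i j
  change partialT v (diagShift (fun _ => (1 : Fn R)) 0 i j) = 0
  unfold diagShift
  split_ifs
  · exact partialT_one v
  · exact partialT_zero v

/-- Differentiating $UU^{-1}=1$ gives $A+U\,\partial_v(U^{-1})=0$; multiply by $U^{-1}$ on the left.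
-/
theorem Band.partial_inv (v : Times) (U : (Band R w σ)ˣ) (A : Band R w σ)
    (h : (U : Band R w σ).partial v = A * U) :
    (↑U⁻¹ : Band R w σ).partial v = -(↑U⁻¹ * A) := by
  have h1 := Band.partial_mul v (U : Band R w σ) ↑U⁻¹
  rw [Units.mul_inv, Band.partial_one, h, mul_assoc, Units.mul_inv, mul_one] at h1
  have h2 := congrArg (fun P => (↑U⁻¹ : Band R w σ) * P) (eq_neg_of_add_eq_zero_right h1.symm)
  simpa only [Units.inv_mul_cancel_left, mul_neg] using h2

theorem partialMat_inv (v : Times) (U : (Band R w σ)ˣ) {A : Mat R} (hA : A ∈ bandSubmodule R w σ)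
    (h : partialMat v (U : Band R w σ).1 = mmul A (U : Band R w σ).1) :
    partialMat v (↑U⁻¹ : Band R w σ).1 = -mmul (↑U⁻¹ : Band R w σ).1 A :=
  congrArg Subtype.val (Band.partial_inv v U ⟨A, hA⟩ (Subtype.ext h))

/-- Needed for $(L_1^n)_u$ acting on $W_1$: an arbitrary upper triangular matrix need not lie in
`Alg₁`, but truncation keeps the bound that $L_1^n$ satisfies. The next lemma serves $(L_2^n)_l$ and
`Alg₂` in the same way. -/
theorem upperPart_mem_bandSubmodule {P : Mat R} (hP : P ∈ bandSubmodule R w σ) :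
    upperPart P ∈ bandSubmodule R w σ := by
  obtain ⟨C, hC⟩ := hP
  refine ⟨C, fun i j => ?_⟩
  unfold upperPart
  split_ifs
  · exact hC i j
  · exact zero_mem _

theorem lowerPart_mem_bandSubmodule {P : Mat R} (hP : P ∈ bandSubmodule R w σ) :
    lowerPart P ∈ bandSubmodule R w σ := by
  obtain ⟨C, hC⟩ := hP
  refine ⟨C, fun i j => ?_⟩
  unfold lowerPart
  split_ifs
  · exact hC i j
  · exact zero_mem _

end Derivation

/-! ### Matrices with one nonzero diagonal -/

section Diagonals

variable {R : Type*} [CommRing R] [Algebra ℚ R] {w : Times → ℕ} {σ : ℤˣ}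

/-- The matrix `diag[a(s)] Λ^r` as an element of the ring of matrices. -/
noncomputable def Band.diag (a : ℤ → Fn R) (r : ℤ) : Band R w σ := ⟨diagShift a r, diagShift_mem a r⟩

theorem Band.diag_mul_diag (a b : ℤ → Fn R) (r s : ℤ) :
    (Band.diag a r * Band.diag b s : Band R w σ) = Band.diag (fun i => a i * b (i + r)) (r + s) := by
  refine Subtype.ext ?_
  funext i j
  change (fsum fun k => diagShift a r i k * diagShift b s k j) =
    diagShift (fun i => a i * b (i + r)) (r + s) i j
  rw [fsum_single _ (i + r) fun k hk => by simp [diagShift, hk]]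
  simp [diagShift, add_assoc]

theorem Band.nsmul_diag (n : ℕ) (a : ℤ → Fn R) (r : ℤ) :
    (n • Band.diag a r : Band R w σ) = Band.diag (fun i => n • a i) r := by
  refine Subtype.ext ?_
  funext i j
  change n • diagShift a r i j = diagShift (fun i => n • a i) r i j
  unfold diagShift
  split_ifs
  · rfl
  · exact smul_zero n

theorem coe_shift_zpow (n : ℤ) :
    ((shift ^ n : (Band R w σ)ˣ) : Band R w σ) = Band.diag (fun _ => 1) n := by
  induction n with
  | zero => rfl
  | succ n ih =>
    rw [zpow_add_one, Units.val_mul, ih]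
    change Band.diag _ _ * Band.diag _ _ = _
    rw [Band.diag_mul_diag]
    simp
  | pred n ih =>
    rw [zpow_sub_one, Units.val_mul, ih]
    change Band.diag _ _ * Band.diag _ _ = _
    rw [Band.diag_mul_diag]
    simp [sub_eq_add_neg]

/-- The recursion of falling factorials, $m!$ times the absorption identity $(m+1)\binom
s{m+1}=s\binom{s-1}m$. -/
theorem factorial_mul_choose_succ (s : ℤ) (m : ℕ) :
    s * (m ! * Ring.choose (s - 1) m) = (m + 1)! * Ring.choose s (m + 1) := by
  have h := Ring.choose_smul_choose s (Nat.le_add_left 1 m)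
  rw [Nat.choose_one_right, Ring.choose_one_right, Nat.add_sub_cancel, nsmul_eq_mul] at h
  push_cast at h
  rw [Nat.factorial_succ]
  push_cast
  linear_combination -(m ! : ℤ) * h

/-- Moving $\Lambda^r$ past the diagonal lowers $p$ by one, so the product of the $m$ factors is the
falling factorial of $p(s)$. The condition on $p$ covers both $\varepsilon$ ($p(s)=s$, $r=-1$) and
$\varepsilon^*$ ($p(s)=-s$, $r=1$). -/
theorem Band.diag_pow (p : ℤ → ℤ) (r : ℤ) (hp : ∀ s, p (s + r) = p s - 1) (m : ℕ) :
    (Band.diag (fun s => (p s : Fn R)) r ^ m : Band R w σ) =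
      m ! • Band.diag (fun s => ((Ring.choose (p s) m : ℤ) : Fn R)) (r * m) := by
  induction m with
  | zero =>
    simp only [pow_zero, Nat.factorial_zero, one_smul, Ring.choose_zero_right, Int.cast_one,
      Nat.cast_zero, mul_zero]
    rfl
  | succ m ih =>
    rw [pow_succ', ih, Band.nsmul_diag, Band.nsmul_diag, Band.diag_mul_diag]
    congr 1
    · funext s
      rw [hp, nsmul_eq_mul, nsmul_eq_mul]
      exact_mod_cast congrArg (Int.cast (R := Fn R)) (factorial_mul_choose_succ (p s) m)
    · push_cast
      ring

/-- The summands of the entry `(i, j)` of `P diag[a(s)] Λ^r Q`. -/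
noncomputable def diagTerm (P Q : Mat R) (a : ℤ → Fn R) (r i j : ℤ) : ℤ → Fn R := fun k =>
  a k * P i k * Q (k + r) j

theorem Band.mul_diag_apply (P : Band R w σ) (a : ℤ → Fn R) (r i k : ℤ) :
    (P * Band.diag a r).1 i (k + r) = a k * P.1 i k := by
  change (fsum fun l => P.1 i l * diagShift a r l (k + r)) = _
  rw [fsum_single _ k fun l hl => by simp [diagShift, Ne.symm hl]]
  simp [diagShift, mul_comm]

/-- After translating the summation index by $r$, these are the terms of an ordinary product of two
matrices of the ring, so both convergence and value of the sum are inherited. -/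
theorem Band.diagTerm_eq (P Q : Band R w σ) (a : ℤ → Fn R) (r i j : ℤ) :
    diagTerm P.1 Q.1 a r i j = fun k =>
      (fun k => (P * Band.diag a r).1 i k * Q.1 k j) (Equiv.addRight r k) := by
  funext k
  exact congrArg (· * Q.1 (k + r) j) (Band.mul_diag_apply P a r i k).symm

theorem Band.summable_diagTerm (P Q : Band R w σ) (a : ℤ → Fn R) (r i j : ℤ) :
    FSummable (diagTerm P.1 Q.1 a r i j) := by
  obtain ⟨C, hC⟩ := (P * Band.diag a r).2
  obtain ⟨D, hD⟩ := Q.2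
  rw [Band.diagTerm_eq]
  exact (fsummable_mul hC hD i j).comp_equiv (Equiv.addRight r)

theorem Band.mul_diag_mul (P Q : Band R w σ) (a : ℤ → Fn R) (r i j : ℤ) :
    (P * Band.diag a r * Q).1 i j = fsum (diagTerm P.1 Q.1 a r i j) := by
  rw [Band.diagTerm_eq]
  exact (fsum_comp_equiv (Equiv.addRight r) fun k => (P * Band.diag a r).1 i k * Q.1 k j).symm

end Diagonals

/-! ### Wave vectors, Kronecker products and triangular parts -/

section Waves

variable {R : Type*} [CommRing R]

theorem mulVec_chi (P : Mat R) : mulVec P (chi R) = P := by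
  funext i k
  change (fsum fun j => P i j * chi R j k) = P i k
  rw [fsum_single _ k fun j hj => by simp [chi, Ne.symm hj]]
  simp [chi]

theorem mulVec_chiStar (P : Mat R) (i k : ℤ) : mulVec P (chiStar R) i k = P i (-k) := by
  change (fsum fun j => P i j * chi R j (-k)) = P i (-k)
  rw [fsum_single _ (-k) fun j hj => by simp [chi, Ne.symm hj]]
  simp [chi]

theorem mulVec_neg (P : Mat R) (v : ℤ → Series R) (i k : ℤ) :
    mulVec P (fun i => -v i) i k = -mulVec P v i k := by
  unfold mulVec
  rw [← fsum_neg]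
  simp only [Pi.neg_apply, mul_neg]

theorem kronecker_neg (q r : ℤ → Series R) (m : ℕ) (n : ℤ) :
    kronecker (fun i => -q i) r m n = -kronecker q r m n := by
  funext i j
  change _ = -(fsum _)
  rw [← fsum_neg]
  simp only [kronecker, Series.taylor, Pi.neg_apply, smul_neg, neg_mul]

/-- The prefactor $\lambda^{-1}$ is absorbed into the adjoint factor, which matches the kernels with
the pairs defining the squared eigenfunction flows. -/
theorem divLam_kronecker (q r : ℤ → Series R) :
    (kronecker q r).divLam = kronecker q fun i => (r i).divVar := by
  funext m n i j
  change (fsum fun k => (q i).taylor m k * r j (n + 1 - k)) =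
    fsum fun k => (q i).taylor m k * r j (n - k + 1)
  simp only [add_sub_right_comm]

theorem lowerPart_zero : lowerPart (0 : Mat R) = 0 := by
  funext i j
  exact ite_self _

theorem upperPart_zero : upperPart (0 : Mat R) = 0 := by
  funext i j
  exact ite_self _

theorem plusPart_left (P : Mat R) : plusPart (P, 0) = upperPart P := by
  rw [plusPart, lowerPart_zero, add_zero]

theorem plusPart_right (P : Mat R) : plusPart (0, P) = lowerPart P := by
  rw [plusPart, upperPart_zero, zero_add]

/-- Since $\varepsilon^T=\mathrm{diag}[s+1]\Lambda$, the summand $\Lambda$ in $\varepsilon^*$ turns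
$-(s+1)$ into $-s$, the exponent carried by $\chi(z^{-1})$. -/
theorem epsStar_eq : epsStar R = diagShift (fun s => ((-s : ℤ) : Fn R)) 1 := by
  funext i j
  change -(diagShift (fun s => (s : Fn R)) (-1) j i) + diagShift (fun _ => 1) 1 i j = _
  unfold diagShift
  by_cases h : j = i + 1
  · subst h
    simp
  · rw [if_neg h, if_neg h, if_neg (by omega), neg_zero, zero_add]

/-- If `∂_v V = -V A`, then the rows of `V` satisfy `∂_v r = -A^T r`. -/
theorem partialT_row {v : Times} {V A : Mat R} (h : partialMat v V = -mmul V A) (i k : ℤ) :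
    partialT v (V k i) = -fsum fun j => A.transpose i j * V k j := by
  simp only [Matrix.transpose_apply, mul_comm (A _ i)]
  exact congrFun₂ h k i

variable [Algebra ℚ R]

theorem minusPart_smul_mul (c : ℚ) (P : Mat R × Mat R) (U : Alg₁ R × Alg₂ R) :
    c • (minusPart P * U) = minusPart (c • P) * U := by
  have h : minusPart (c • P) = c • minusPart P := by
    refine Prod.ext (Subtype.ext ?_) (Subtype.ext ?_)
    · funext i j
      change lowerPart (c • P.1) i j - lowerPart (c • P.2) i j =
        c • (lowerPart P.1 i j - lowerPart P.2 i j)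
      unfold lowerPart
      split_ifs
      · exact (smul_sub c (P.1 i j) (P.2 i j)).symm
      · simp
    · funext i j
      change upperPart (c • P.2) i j - upperPart (c • P.1) i j =
        c • (upperPart P.2 i j - upperPart P.1 i j)
      unfold upperPart
      split_ifs
      · exact (smul_sub c (P.2 i j) (P.1 i j)).symm
      · simp
  rw [h, smul_mul_assoc]

theorem minusPart_left (P : Mat R) :
    minusPart (P, 0) = (⟨lowerPart P, lowerPart_mem P⟩, -⟨upperPart P, upperPart_mem P⟩) := by
  refine Prod.ext (Subtype.ext ?_) (Subtype.ext ?_)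
  · change lowerPart P - lowerPart 0 = lowerPart P
    rw [lowerPart_zero, sub_zero]
  · change upperPart 0 - upperPart P = -upperPart P
    rw [upperPart_zero, zero_sub]

theorem minusPart_right (P : Mat R) :
    minusPart (0, P) = (-⟨lowerPart P, lowerPart_mem P⟩, ⟨upperPart P, upperPart_mem P⟩) := by
  refine Prod.ext (Subtype.ext ?_) (Subtype.ext ?_)
  · change lowerPart 0 - lowerPart P = -lowerPart P
    rw [lowerPart_zero, zero_sub]
  · change upperPart P - upperPart 0 = upperPart P
    rw [upperPart_zero, sub_zero]

/-- Both components of $(P_1,P_2)_-$ depend only on $P_1-P_2$. This is the origin of the sign in the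
eigenfunction $-\Psi_2(\mu^{-1})$. -/
theorem minusPart_neg_left (P : Mat R) : minusPart (-P, 0) = minusPart (0, P) := by
  rw [minusPart_left, minusPart_right]
  refine Prod.ext (Subtype.ext ?_) (Subtype.ext ?_) <;> funext i j
  · change lowerPart (-P) i j = -lowerPart P i j
    unfold lowerPart
    split_ifs <;> simp
  · change -upperPart (-P) i j = upperPart P i j
    unfold upperPart
    split_ifs <;> simp

end Waves

/-! ### The generating series as Kronecker products -/

namespace Dressing

variable {R : Type*} [CommRing R] [Algebra ℚ R] (D : Dressing R)

theorem Ψ₁_apply (i k : ℤ) : D.Ψ₁ i k = D.W.1.1 i k := by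
  rw [Ψ₁, mulVec_chi]

theorem Ψ₂_apply (i k : ℤ) : D.Ψ₂ i k = D.W.2.1 i k := by
  rw [Ψ₂, mulVec_chi]

theorem Ψ₁star_apply (i k : ℤ) : D.Ψ₁star i k = (↑D.W₁⁻¹ : Alg₁ R).1 (-k) i :=
  mulVec_chiStar _ i k

theorem Ψ₂star_apply (i k : ℤ) : D.Ψ₂star i k = (↑D.W₂⁻¹ : Alg₂ R).1 (-k) i :=
  mulVec_chiStar _ i k

theorem M₁_pow_mul_L₁pow (m : ℕ) (l : ℤ) :
    D.M₁ ^ m * D.L₁pow l = m ! • (D.W.1 *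
      Band.diag (fun s => ((Ring.choose s m : ℤ) : Fn R)) (l - m) * (↑D.W₁⁻¹ : Alg₁ R)) := by
  have hε : (⟨eps R, diagShift_mem _ _⟩ : Alg₁ R) ^ m =
      m ! • Band.diag (fun s => ((Ring.choose s m : ℤ) : Fn R)) (-1 * m) :=
    Band.diag_pow (fun s => s) (-1) (fun s => rfl) m
  rw [L₁pow, L₁, conj_zpow, M₁, Units.conj_pow, hε, Units.val_mul, Units.val_mul, coe_shift_zpow]
  simp only [mul_assoc, Units.inv_mul_cancel_left]
  rw [smul_mul_assoc, mul_smul_comm, ← mul_assoc (Band.diag _ _), Band.diag_mul_diag]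
  simp only [mul_one, neg_one_mul, neg_add_eq_sub]
  rfl

theorem M₂_pow_mul_L₂pow (m : ℕ) (l : ℤ) :
    D.M₂ ^ m * D.L₂pow l = m ! • (D.W.2 *
      Band.diag (fun s => ((Ring.choose (-s) m : ℤ) : Fn R)) (m - l) * (↑D.W₂⁻¹ : Alg₂ R)) := by
  have hε : (⟨epsStar R, epsStar_mem⟩ : Alg₂ R) ^ m =
      m ! • Band.diag (fun s => ((Ring.choose (-s) m : ℤ) : Fn R)) (1 * m) := by
    rw [← Band.diag_pow (fun s => -s) 1 (fun s => by ring) m]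
    exact congrArg (· ^ m) (Subtype.ext epsStar_eq)
  rw [L₂pow, L₂, conj_zpow, M₂, Units.conj_pow, hε, Units.val_mul, Units.val_mul, inv_zpow',
    coe_shift_zpow]
  simp only [mul_assoc, Units.inv_mul_cancel_left]
  rw [smul_mul_assoc, mul_smul_comm, ← mul_assoc (Band.diag _ _), Band.diag_mul_diag]
  simp only [mul_one, one_mul, ← sub_eq_add_neg]
  rfl

theorem Y₁_eq (m : ℕ) (n : ℤ) :
    D.Y₁ m n = D.W.1 * Band.diag (fun s => ((Ring.choose s m : ℤ) : Fn R)) (-n - 1 - m) *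
      (↑D.W₁⁻¹ : Alg₁ R) := by
  have hm : (m ! : ℚ) ≠ 0 := by positivity
  rw [Y₁, genSeries, M₁_pow_mul_L₁pow, ← Nat.cast_smul_eq_nsmul ℚ, inv_smul_smul₀ hm]
  -- With $l=-n-m-1$ the power of $L_1$ is $m+l=-n-1$, and $\varepsilon^m$ contributes another $-m$
  -- to the shift.
  congr 3
  ring

theorem Y₂_eq (m : ℕ) (n : ℤ) :
    D.Y₂ m n = D.W.2 * Band.diag (fun s => ((Ring.choose (-s) m : ℤ) : Fn R)) (m + n + 1) *
      (↑D.W₂⁻¹ : Alg₂ R) := by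
  have hm : (m ! : ℚ) ≠ 0 := by positivity
  rw [Y₂, genSeries, M₂_pow_mul_L₂pow, ← Nat.cast_smul_eq_nsmul ℚ, inv_smul_smul₀ hm]
  congr 3
  ring

theorem kronecker₁_term (m : ℕ) (n i j k : ℤ) :
    (D.Ψ₁ i).taylor m k * D.Ψ₁star j (n - k) =
      diagTerm D.W.1.1 (↑D.W₁⁻¹ : Alg₁ R).1 (fun s => ((Ring.choose s m : ℤ) : Fn R)) (-n - m) i j
        (Equiv.addRight (m : ℤ) k) := by
  -- Here $k$ is the power of $\lambda$ left by the Taylor expansion of $\mu^s$, so the column of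
  -- $W_1$ is $s=k+m$.
  have h : k + m + (-n - m) = -(n - k) := by ring
  rw [Series.taylor, Ψ₁_apply, Ψ₁star_apply, zsmul_eq_mul, Equiv.coe_addRight, diagTerm, h]

theorem kronecker₂_term (m : ℕ) (n i j k : ℤ) :
    (D.Ψ₂ i).inv.taylor m k * (D.Ψ₂star j).inv (n - k) =
      diagTerm D.W.2.1 (↑D.W₂⁻¹ : Alg₂ R).1 (fun s => ((Ring.choose (-s) m : ℤ) : Fn R)) (m + n) i j
        ((Equiv.addRight (m : ℤ)).trans (Equiv.neg ℤ) k) := by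
  -- The inverted argument makes the exponent $-s$ equal to $k+m$, so the reindexing is a
  -- translation followed by a reflection.
  have h : -(k + m) + (m + n) = n - k := by ring
  rw [Series.taylor, Series.inv, Series.inv, Ψ₂_apply, Ψ₂star_apply, zsmul_eq_mul,
    Equiv.trans_apply, Equiv.coe_addRight, Equiv.neg_apply, diagTerm, neg_neg, neg_neg, h]

theorem kroneckerSummable₁ : KroneckerSummable D.Ψ₁ D.Ψ₁star := fun m n i j => by
  simp only [kronecker₁_term]
  exact (Band.summable_diagTerm D.W.1 (↑D.W₁⁻¹ : Alg₁ R) _ _ i j).comp_equiv _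

theorem kroneckerSummable₂ :
    KroneckerSummable (fun i => (D.Ψ₂ i).inv) fun i => (D.Ψ₂star i).inv := fun m n i j => by
  simp only [kronecker₂_term]
  exact (Band.summable_diagTerm D.W.2 (↑D.W₂⁻¹ : Alg₂ R) _ _ i j).comp_equiv _

theorem Y₁_eq_kernel₁ (m : ℕ) (n : ℤ) : (D.Y₁ m n : Mat R) = D.kernel₁ m n := by
  funext i j
  rw [Y₁_eq, Band.mul_diag_mul]
  -- The prefactor $\lambda^{-1}$ makes the coefficient at $\lambda^n$ that of the bare product at
  -- $\lambda^{n+1}$.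
  change _ = fsum fun k => (D.Ψ₁ i).taylor m k * D.Ψ₁star j (n + 1 - k)
  simp only [kronecker₁_term]
  rw [fsum_comp_equiv, neg_add']

theorem Y₂_eq_kernel₂ (m : ℕ) (n : ℤ) : (D.Y₂ m n : Mat R) = D.kernel₂ m n := by
  funext i j
  rw [Y₂_eq, Band.mul_diag_mul]
  change _ = fsum fun k => (D.Ψ₂ i).inv.taylor m k * (D.Ψ₂star j).inv (n + 1 - k)
  simp only [kronecker₂_term]
  rw [fsum_comp_equiv, add_assoc]

/-! ### Eigenfunctions and adjoint eigenfunctions -/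

variable {D}

theorem IsToda.isEigenfunction_Ψ₁ (hD : D.IsToda) : D.IsEigenfunction D.Ψ₁ where
  x n i k := by
    rw [Ψ₁, mulVec_chi, ← plusPart_left]
    exact congrFun₂ (hD.x_W₁ n) i k
  y n i k := by
    rw [Ψ₁, mulVec_chi, ← plusPart_right]
    exact congrFun₂ (hD.y_W₁ n) i k

theorem IsToda.isEigenfunction_q₂ (hD : D.IsToda) : D.IsEigenfunction D.q₂ where
  x n i k := by
    unfold q₂
    rw [mulVec_neg, Pi.neg_apply, partialT_neg, Ψ₂, mulVec_chi, ← plusPart_left]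
    exact congrArg Neg.neg (congrFun₂ (hD.x_W₂ n) i (-k))
  y n i k := by
    unfold q₂
    rw [mulVec_neg, Pi.neg_apply, partialT_neg, Ψ₂, mulVec_chi, ← plusPart_right]
    exact congrArg Neg.neg (congrFun₂ (hD.y_W₂ n) i (-k))

theorem IsToda.isAdjointEigenfunction_r₁ (hD : D.IsToda) : D.IsAdjointEigenfunction D.r₁ where
  x n i k := by
    simp only [mulVec, r₁, Series.divVar, Ψ₁star_apply]
    -- The components of $\Psi_1^*$ are entries of $W_1^{-1}$ with its row index negated;
    -- multiplying by $z^{-1}$ only relabels the rows, so the row equation applies with the row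
    -- found by unification.
    refine partialT_row (partialMat_inv _ D.W₁ (upperPart_mem_bandSubmodule (D.L₁pow n).2) ?_) i _
    rw [← plusPart_left]
    exact hD.x_W₁ n
  y n i k := by
    simp only [mulVec, r₁, Series.divVar, Ψ₁star_apply]
    refine partialT_row (partialMat_inv _ D.W₁ (lowerPart_mem _) ?_) i _
    rw [← plusPart_right]
    exact hD.y_W₁ n

theorem IsToda.isAdjointEigenfunction_r₂ (hD : D.IsToda) : D.IsAdjointEigenfunction D.r₂ where
  x n i k := by
    simp only [mulVec, r₂, Series.divVar, Series.inv, Ψ₂star_apply]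
    refine partialT_row (partialMat_inv _ D.W₂ (upperPart_mem _) ?_) i _
    rw [← plusPart_left]
    exact hD.x_W₂ n
  y n i k := by
    simp only [mulVec, r₂, Series.divVar, Series.inv, Ψ₂star_apply]
    refine partialT_row (partialMat_inv _ D.W₂ (lowerPart_mem_bandSubmodule (D.L₂pow n).2) ?_) i _
    rw [← plusPart_right]
    exact hD.y_W₂ n

/-! ### Squared eigenfunction flows and additional symmetries -/

variable (D)

theorem alphaFlow₁_apply (m : ℕ) (n : ℤ) :
    D.alphaFlow₁ m n = minusPart (D.kernel₁ m n, 0) * D.W := by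
  rw [minusPart_left]
  exact Prod.ext rfl (neg_mul _ _).symm

theorem alphaFlow₂_apply (m : ℕ) (n : ℤ) :
    D.alphaFlow₂ m n = minusPart (0, D.kernel₂ m n) * D.W := by
  rw [minusPart_right]
  exact Prod.ext (neg_mul _ _).symm rfl

theorem alphaFlow₁_eq_sqFlow : D.alphaFlow₁ = D.sqFlow D.Ψ₁ D.r₁ := by
  funext m n
  rw [alphaFlow₁_apply, kernel₁, divLam_kronecker]
  rfl

theorem alphaFlow₂_eq_sqFlow : D.alphaFlow₂ = D.sqFlow D.q₂ D.r₂ := by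
  funext m n
  rw [alphaFlow₂_apply, kernel₂, divLam_kronecker, ← minusPart_neg_left, ← kronecker_neg]
  rfl

theorem alphaFlow₁_eq_genSeries :
    D.alphaFlow₁ = -genSeries (fun m k => D.addFlowX m (m + k)) := by
  funext m n
  rw [alphaFlow₁_apply, ← Y₁_eq_kernel₁]
  change _ = -(((m ! : ℚ)⁻¹) • -(minusPart (_, 0) * D.W))
  -- The sign of the additional flow cancels the sign of the generating formula, and $1/m!$ moves
  -- inside $(\cdot)_-$ to complete the coefficient of $Y_1$.
  rw [smul_neg, neg_neg, minusPart_smul_mul, Prod.smul_mk, smul_zero]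
  rfl

theorem alphaFlow₂_eq_genSeries :
    D.alphaFlow₂ = -genSeries (fun m k => D.addFlowY m (m + k)) := by
  funext m n
  rw [alphaFlow₂_apply, ← Y₂_eq_kernel₂]
  change _ = -(((m ! : ℚ)⁻¹) • -(minusPart (0, _) * D.W))
  rw [smul_neg, neg_neg, minusPart_smul_mul, Prod.smul_mk, smul_zero]
  rfl

end Dressing

end Toda

theorem mainTheorem2 {R : Type*} [CommRing R] [Algebra ℚ R] (D : Toda.Dressing R)
    (hD : D.IsToda) :
    -- the generating series are Kronecker products of wave functions, all sums being summable
    Toda.KroneckerSummable D.Ψ₁ D.Ψ₁star ∧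
    Toda.KroneckerSummable (fun i => (D.Ψ₂ i).inv) (fun i => (D.Ψ₂star i).inv) ∧
    (∀ m n, (D.Y₁ m n : Toda.Mat R) = D.kernel₁ m n) ∧
    (∀ m n, (D.Y₂ m n : Toda.Mat R) = D.kernel₂ m n) ∧
    -- the two alpha flows are squared eigenfunction flows
    D.IsEigenfunction D.Ψ₁ ∧ D.IsAdjointEigenfunction D.r₁ ∧
    D.IsEigenfunction D.q₂ ∧ D.IsAdjointEigenfunction D.r₂ ∧
    D.alphaFlow₁ = D.sqFlow D.Ψ₁ D.r₁ ∧
    D.alphaFlow₂ = D.sqFlow D.q₂ D.r₂ ∧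
    -- they generate the additional flows
    D.alphaFlow₁ = -Toda.genSeries (fun m k => D.addFlowX m (m + k)) ∧
    D.alphaFlow₂ = -Toda.genSeries (fun m k => D.addFlowY m (m + k)) :=
  ⟨D.kroneckerSummable₁, D.kroneckerSummable₂, D.Y₁_eq_kernel₁, D.Y₂_eq_kernel₂,
    hD.isEigenfunction_Ψ₁, hD.isAdjointEigenfunction_r₁, hD.isEigenfunction_q₂,
    hD.isAdjointEigenfunction_r₂, D.alphaFlow₁_eq_sqFlow, D.alphaFlow₂_eq_sqFlow,
    D.alphaFlow₁_eq_genSeries, D.alphaFlow₂_eq_genSeries⟩
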